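/- Let $M$ be a connected smooth $7$-manifold (without boundary, not necessarily compact) and let $\varphi$ be a $G_2$-structure on $M$, i.e. a smooth $3$-form such that around every point there is a smooth local frame $(e_1,\dots,e_7)$ of $TM$ with dual coframe $(\omega_1,\dots,\omega_7)$ for which $$\varphi=\omega_{123}+\omega_{145}+\omega_{167}+\omega_{246}-\omega_{257}-\omega_{347}-\omega_{356},\qquad \omega_{ijk}=\omega_i\wedge\omega_j\wedge\omega_k .$$ Since the subgroup $G_2\subset GL(7,\mathbb R)$ preserving this model form lies in $SO(7)$, $\varphi$ determines a Riemannian metric $g_\varphi$ and an orientation on $M$ for which all such frames are oriented orthonormal; let $\ast$ be the corresponding Hodge star, $\delta=(-1)^p\ast d\,\ast$ the codifferential on $p$-forms, and $\Delta=d\delta+\delta d$ the Hodge Laplacian of $g_\varphi$. Put $\Omega^3_1=\{f\varphi : f\in C^\infty(M)\}$, and call $\varphi$ an eigenform if $\Delta\varphi=c\,\varphi$ for some constant $c\in\mathbb R$. Suppose that $\varphi$ is closed, $d\varphi=0$. Then $\varphi$ is an eigenform if and only if $\Delta\varphi\in\Omega^3_1$. -/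

import Mathlib

open scoped Manifold ContDiff
open Module

/-! ### Linear algebra: the Hodge star and the model form -/

section LinearAlgebra

variable {V : Type*} [AddCommGroup V] [Module ℝ V] [TopologicalSpace V]
  [IsTopologicalAddGroup V] [ContinuousSMul ℝ V] [T2Space V]

/-- For a basis `b` of `V` with dual basis `b¹, …, bⁿ` and vectors `w = (w₁, …, w_k)`, the `l`-form
`(v₁, …, v_l) ↦ (b¹ ∧ ⋯ ∧ bⁿ)(w₁, …, w_k, v₁, …, v_l)`, where `k + l = n`. -/
noncomputable def contractVolume {n k l : ℕ} (b : Basis (Fin n) ℝ V) (h : k + l = n)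
    (w : Fin k → V) : V [⋀^Fin l]→L[ℝ] ℝ where
  toFun v := b.det (Fin.append w v ∘ Fin.cast h.symm)
  map_update_add' v i x y := by
    subst h
    have key : ∀ z : V, Fin.append w (Function.update v i z) ∘ Fin.cast rfl
        = Function.update (Fin.append w v) (Fin.natAdd k i) z := by
      intro z
      funext a
      refine Fin.addCases (fun c => ?_) (fun c => ?_) a
      · have hne : Fin.castAdd l c ≠ Fin.natAdd k i := by
          intro hc
          have h1 := congrArg Fin.val hc
          simp at h1
          omega
        simp [Function.update_of_ne hne]
      · rcases eq_or_ne c i with rfl | hci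
        · simp
        · have hne : Fin.natAdd k c ≠ Fin.natAdd k i := fun hc => hci (Fin.natAdd_injective _ _ hc)
          simp [Function.update_of_ne hne, Function.update_of_ne hci]
    have := Subsingleton.elim ‹DecidableEq (Fin l)› (instDecidableEqFin l)
    subst this
    rw [key, key, key, AlternatingMap.map_update_add]
  map_update_smul' v i c x := by
    subst h
    have key : ∀ z : V, Fin.append w (Function.update v i z) ∘ Fin.cast rfl
        = Function.update (Fin.append w v) (Fin.natAdd k i) z := by
      intro z
      funext a
      refine Fin.addCases (fun c => ?_) (fun c => ?_) a
      · have hne : Fin.castAdd l c ≠ Fin.natAdd k i := by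
          intro hc
          have h1 := congrArg Fin.val hc
          simp at h1
          omega
        simp [Function.update_of_ne hne]
      · rcases eq_or_ne c i with rfl | hci
        · simp
        · have hne : Fin.natAdd k c ≠ Fin.natAdd k i := fun hc => hci (Fin.natAdd_injective _ _ hc)
          simp [Function.update_of_ne hne, Function.update_of_ne hci]
    have := Subsingleton.elim ‹DecidableEq (Fin l)› (instDecidableEqFin l)
    subst this
    rw [key, key, AlternatingMap.map_update_smul]
  map_eq_zero_of_eq' v i j hv hij := by
    subst h
    refine b.det.map_eq_zero_of_eq (i := Fin.natAdd k i) (j := Fin.natAdd k j) _ ?_ ?_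
    · simpa using hv
    · intro hc
      exact hij (Fin.natAdd_injective _ _ hc)
  cont := by
    subst h
    have hfin : FiniteDimensional ℝ V := b.finiteDimensional_of_finite
    have hb : ∀ i, Continuous fun x : V => b.repr x i := fun i =>
      (b.coord i).continuous_of_finiteDimensional
    have : (fun v : Fin l → V => b.det (Fin.append w v ∘ Fin.cast rfl))
        = fun v => (Matrix.of fun i j => b.repr (Fin.append w v j) i).det := by
      ext v
      rw [Basis.det_apply]
      rfl
    show Continuous (fun v : Fin l → V => b.det (Fin.append w v ∘ Fin.cast rfl))
    rw [this]
    refine Continuous.matrix_det (continuous_matrix fun i j => ?_)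
    refine (hb i).comp ?_
    refine Fin.addCases (fun a => ?_) (fun a => ?_) j
    · simpa using continuous_const
    · simpa using continuous_apply a

/-- The Hodge star `Λᵏ V* → Λˡ V*`, `k + l = n`, of the inner product and the orientation on `V` for
which `b` is an oriented orthonormal basis, that is,
`(⋆α)(v) = (1 / k!) ∑_{i₁, …, i_k} α(b_{i₁}, …, b_{i_k}) vol(b_{i₁}, …, b_{i_k}, v₁, …, v_l)`
with `vol = b¹ ∧ ⋯ ∧ bⁿ`; equivalently `β ∧ ⋆α = ⟨β, α⟩ vol` for all `k`-forms `β`. -/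
noncomputable def hodgeStarOfBasis {n k l : ℕ} (b : Basis (Fin n) ℝ V) (h : k + l = n)
    (α : V [⋀^Fin k]→L[ℝ] ℝ) : V [⋀^Fin l]→L[ℝ] ℝ :=
  ((k.factorial : ℝ)⁻¹) •
    ∑ i : Fin k → Fin n, α (fun a => b (i a)) • contractVolume b h (fun a => b (i a))

/-- The elementary 3-form `dx_i ∧ dx_j ∧ dx_k` on `ℝ⁷` (indices start at `0`), evaluated on
`(u 0, u 1, u 2)`. -/
noncomputable def dx3 (i j k : Fin 7) (u : Fin 3 → Fin 7 → ℝ) : ℝ :=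
  Matrix.det (Matrix.of fun r s : Fin 3 => u r (![i, j, k] s))

/-- The model form
`φ₀ = dx₁₂₃ + dx₁₄₅ + dx₁₆₇ + dx₂₄₆ - dx₂₅₇ - dx₃₄₇ - dx₃₅₆` on `ℝ⁷`
(the indices are shifted by one in the code). -/
noncomputable def phi0 (u : Fin 3 → Fin 7 → ℝ) : ℝ :=
  dx3 0 1 2 u + dx3 0 3 4 u + dx3 0 5 6 u + dx3 1 3 5 u
    - dx3 1 4 6 u - dx3 2 3 6 u - dx3 2 4 5 u

/-- The basis `b` is adapted to the 3-form `φ` on `V`: with the dual basis `ω₁, …, ω₇`,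
`φ = ω₁₂₃ + ω₁₄₅ + ω₁₆₇ + ω₂₄₆ - ω₂₅₇ - ω₃₄₇ - ω₃₅₆`. -/
def IsAdaptedBasis (φ : V [⋀^Fin 3]→L[ℝ] ℝ) (b : Basis (Fin 7) ℝ V) : Prop :=
  ∀ u : Fin 3 → V, φ u = phi0 (fun r => b.repr (u r))

open Classical in
/-- The Hodge star `Λᵏ V* → Λˡ V*`, `k + l = 7`, of the inner product and the orientation induced by
a 3-form `φ` that has an adapted basis: those for which adapted bases are oriented orthonormal.
Two adapted bases differ by an element of `G₂ ⊂ SO(7)`, so they induce the same inner product and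
orientation. Junk value `0` if `φ` has no adapted basis. -/
noncomputable def g2Star (φ : V [⋀^Fin 3]→L[ℝ] ℝ) {k l : ℕ} (h : k + l = 7)
    (α : V [⋀^Fin k]→L[ℝ] ℝ) : V [⋀^Fin l]→L[ℝ] ℝ :=
  if hb : ∃ b : Basis (Fin 7) ℝ V, IsAdaptedBasis φ b then hodgeStarOfBasis hb.choose h α else 0

end LinearAlgebra

/-! ### Differential forms on a 7-manifold -/

section Forms

instance instT2SpaceTangentSpaceSeven {M : Type*} [TopologicalSpace M]
    [ChartedSpace (EuclideanSpace ℝ (Fin 7)) M] (x : M) : T2Space (TangentSpace (𝓡 7) x) :=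
  inferInstanceAs (T2Space (EuclideanSpace ℝ (Fin 7)))

variable {M : Type*} [TopologicalSpace M] [ChartedSpace (EuclideanSpace ℝ (Fin 7)) M]

variable (M) in
/-- (Not necessarily smooth) differential `k`-forms on `M`. -/
abbrev DiffForm (k : ℕ) : Type _ := (x : M) → TangentSpace (𝓡 7) x [⋀^Fin k]→L[ℝ] ℝ

/-- The form `η` written in the chart at `x₀`: its pullback under the inverse of that chart. -/
noncomputable def DiffForm.inChart {k : ℕ} (η : DiffForm M k) (x₀ : M)
    (y : EuclideanSpace ℝ (Fin 7)) : EuclideanSpace ℝ (Fin 7) [⋀^Fin k]→L[ℝ] ℝ :=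
  (η ((extChartAt (𝓡 7) x₀).symm y)).compContinuousLinearMap
    (mfderiv (𝓡 7) (𝓡 7) (extChartAt (𝓡 7) x₀).symm y)

/-- Smooth differential forms: all components in charts are smooth. -/
def DiffForm.IsSmooth {k : ℕ} (η : DiffForm M k) : Prop :=
  ∀ x₀ : M, ContDiffOn ℝ ∞ (DiffForm.inChart η x₀) (extChartAt (𝓡 7) x₀).target

/-- The exterior derivative of a form on `M`: at `x`, the exterior derivative of the form written in
the chart at `x`, pulled back to `M`. -/
noncomputable def DiffForm.extD {k : ℕ} (η : DiffForm M k) : DiffForm M (k + 1) := fun x =>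
  ContinuousAlternatingMap.compContinuousLinearMap
    (extDeriv (DiffForm.inChart η x) (extChartAt (𝓡 7) x x) :
      EuclideanSpace ℝ (Fin 7) [⋀^Fin (k + 1)]→L[ℝ] ℝ)
    (mfderiv (𝓡 7) (𝓡 7) (extChartAt (𝓡 7) x) x)

/-- A 3-form `φ` on `M` is a `G₂`-structure if it is smooth and, around every point, there is a
smooth local frame of `TM` in which `φ` has the form of the model `φ₀`. -/
def IsG2Structure [IsManifold (𝓡 7) ∞ M] (φ : DiffForm M 3) : Prop :=
  DiffForm.IsSmooth φ ∧
    ∀ x : M, ∃ U : Set M, IsOpen U ∧ x ∈ U ∧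
      ∃ e : Fin 7 → (y : M) → TangentSpace (𝓡 7) y,
        ∃ he : IsLocalFrameOn (𝓡 7) (EuclideanSpace ℝ (Fin 7)) ∞ e U,
          ∀ (y : M) (hy : y ∈ U), IsAdaptedBasis (φ y) (he.toBasisAt hy)

/-- The Hodge star on forms, of the metric `g_φ` and the orientation induced by `φ`. -/
noncomputable def DiffForm.star (φ : DiffForm M 3) {k l : ℕ} (h : k + l = 7) (α : DiffForm M k) :
    DiffForm M l := fun x => g2Star (φ x) h (α x)

/-- The codifferential `δ = (-1)ᵖ ⋆ d ⋆` on `p`-forms, `p = k + 1`, of the metric `g_φ`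
on the 7-manifold `M`. -/
noncomputable def DiffForm.codiff (φ : DiffForm M 3) {k l : ℕ} (h : (k + 1) + l = 7)
    (α : DiffForm M (k + 1)) : DiffForm M k :=
  (-1 : ℝ) ^ (k + 1) • DiffForm.star φ (by omega : (l + 1) + k = 7)
    (DiffForm.extD (DiffForm.star φ h α))

/-- The (nonnegative) Hodge Laplacian `Δ_φ = dδ + δd` on 3-forms, of the metric `g_φ`. -/
noncomputable def DiffForm.hodgeLaplacian (φ α : DiffForm M 3) : DiffForm M 3 :=
  DiffForm.extD (DiffForm.codiff φ (k := 2) (l := 4) rfl α)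
    + DiffForm.codiff φ (k := 3) (l := 3) rfl (DiffForm.extD α)

/-- The form `φ` is closed: `dφ = 0`. -/
def DiffForm.IsClosedForm {k : ℕ} (φ : DiffForm M k) : Prop := DiffForm.extD φ = 0

/-- The 3-form `φ` is an eigenform: `Δ_φ φ = c φ` for a constant `c`. -/
def IsEigenform (φ : DiffForm M 3) : Prop :=
  ∃ c : ℝ, DiffForm.hodgeLaplacian φ φ = c • φ

/-- `Ω³₁ = {f φ | f ∈ C^∞(M)}`. -/
def Omega31 (φ : DiffForm M 3) : Set (DiffForm M 3) :=
  {η | ∃ f : M → ℝ, ContMDiff (𝓡 7) 𝓘(ℝ, ℝ) ∞ f ∧ η = fun x => f x • φ x}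

end Forms

/-! If `φ` is closed, then `Δφ = dδφ` is exact, so `Δφ = fφ` gives `0 = d(fφ) = df ∧ φ`. Wedging
with `φ` is injective on 1-forms (`IsAdaptedBasis.eq_zero_of_wedge_eq_zero`), hence `df = 0`, and
`f` is constant because `M` is connected. Conversely, a constant is a smooth function.

Most of the work justifies `d(dδφ) = 0`, which needs `δφ` to be smooth, although the star is defined
pointwise from an arbitrarily chosen adapted basis. One must see that the choice is immaterial, i.e.
that `G₂ ⊂ SO(7)`. The 7-form `(u ⌟ φ) ∧ (v ⌟ φ) ∧ φ` is a fixed nonzero multiple of `⟨u, v⟩ vol` in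
every adapted basis. Comparing two such bases with transition matrix `A` gives `det A • AᵀA = 1`;
determinants give `(det A)⁹ = 1`, so `det A = 1` and `A` is orthogonal (`IsAdaptedBasis.det_eq_one`,
`IsAdaptedBasis.toMatrix_mul_transpose`). The star may therefore be computed in a smooth local
frame, where its components are visibly smooth (`DiffForm.IsSmooth.star`). -/

/-! ### The cubic contraction of the model form with the volume form -/

section Combinatorics

/-- The coefficients of the model form, for indices below `7`: the base-four digits of the literal
are `0`, `1`, `2` for the coefficients `0`, `1`, `-1`. -/
def phiCoeff (i j k : ℕ) : ℤ :=
  Nat.casesOn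
    (Nat.mod (Nat.shiftRight
      0x800400400800800400000400000400080800040800000800800000008400400004000800040004000400080008000400400800800000000080040400080800040000040000080800400008004000080040000
      (2 * (49 * i + 7 * j + k))) 4) 0 fun n => Nat.casesOn n 1 fun _ => Int.negSucc 0

/-- The sign of `b - a`. -/
def cmpSign (a b : ℕ) : ℤ := cond (Nat.blt a b) 1 (cond (Nat.blt b a) (Int.negSucc 0) 0)

/-- Multiplication that does not evaluate the second factor if the first one vanishes. -/
def lazyMul (x y : ℤ) : ℤ :=
  Int.casesOn x (fun n => Nat.casesOn n 0 fun m => Int.ofNat (m + 1) * y) fun n => Int.negSucc n * y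

theorem lazyMul_eq (x y : ℤ) : lazyMul x y = x * y := by
  rcases x with (_ | n) | n
  · simp [lazyMul]
  · rfl
  · rfl

/-- The sum of `f` over the numbers below `7`. -/
def sumSeven (f : ℕ → ℤ) : ℤ := f 0 + f 1 + f 2 + f 3 + f 4 + f 5 + f 6

theorem sumSeven_eq (f : ℕ → ℤ) : sumSeven f = ∑ i : Fin 7, f i := by
  rw [Fin.sum_univ_seven]; rfl

/-- The contraction of `(e_i ⌟ φ₀) ⊗ (e_j ⌟ φ₀) ⊗ φ₀` with the Levi-Civita symbol, in a form that is
quick to evaluate. -/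
def phiCubeContraction (i j : ℕ) : ℤ :=
  sumSeven fun a => sumSeven fun b => lazyMul (phiCoeff i a b) <| lazyMul (cmpSign a b) <|
  sumSeven fun c => lazyMul (cmpSign a c) <| lazyMul (cmpSign b c) <|
  sumSeven fun d => lazyMul (phiCoeff j c d) <| lazyMul (cmpSign a d) <| lazyMul (cmpSign b d) <|
    lazyMul (cmpSign c d) <|
  sumSeven fun e => lazyMul (cmpSign a e) <| lazyMul (cmpSign b e) <| lazyMul (cmpSign c e) <|
    lazyMul (cmpSign d e) <|
  sumSeven fun f => lazyMul (cmpSign a f) <| lazyMul (cmpSign b f) <| lazyMul (cmpSign c f) <|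
    lazyMul (cmpSign d f) <| lazyMul (cmpSign e f) <|
  sumSeven fun g => lazyMul (phiCoeff e f g) <| lazyMul (cmpSign a g) <| lazyMul (cmpSign b g) <|
    lazyMul (cmpSign c g) <| lazyMul (cmpSign d g) <| lazyMul (cmpSign e g) <| cmpSign f g

/-- The full sum has `7⁷` terms for each pair; vanishing factors prune it early enough for kernel
evaluation. The classical constant is `6`, and summing over all permutations without normalisation
multiplies it by `2! · 2! · 3! = 24`. -/
theorem phiCubeContraction_eq :
    ∀ i j : Fin 7, phiCubeContraction i j = if i = j then 144 else 0 := by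
  decide +kernel

theorem Fintype.sum_fin_succ_arrow {α β : Type*} [Fintype α] [AddCommMonoid β] {n : ℕ}
    (f : (Fin (n + 1) → α) → β) :
    ∑ x, f x = ∑ a, ∑ x : Fin n → α, f (Matrix.vecCons a x) := by
  rw [← (Fin.consEquiv fun _ : Fin (n + 1) => α).sum_comp, Fintype.sum_prod_type]
  rfl

/-- The Levi-Civita symbol. -/
def leviCivita {n : ℕ} (x : Fin n → Fin 7) : ℤ :=
  ∏ j, ∏ i ∈ Finset.Iio j, cmpSign (x i) (x j)

theorem cmpSign_of_lt {a b : ℕ} (h : a < b) : cmpSign a b = 1 := by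
  rw [cmpSign, show Nat.blt a b = true from Nat.blt_eq.mpr h, cond_true]

theorem cmpSign_of_gt {a b : ℕ} (h : b < a) : cmpSign a b = -1 := by
  rw [cmpSign, Bool.eq_false_of_not_eq_true fun h' => absurd (Nat.blt_eq.mp h') h.le.not_gt,
    show Nat.blt b a = true from Nat.blt_eq.mpr h]
  rfl

theorem cmpSign_self (a : ℕ) : cmpSign a a = 0 := by
  rw [cmpSign, Bool.eq_false_of_not_eq_true fun h' => absurd (Nat.blt_eq.mp h') (lt_irrefl a)]
  rfl

theorem leviCivita_eq_zero {n : ℕ} {x : Fin n → Fin 7} (hx : ¬ Function.Injective x) :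
    leviCivita x = 0 := by
  simp only [Function.Injective, not_forall] at hx
  obtain ⟨i, j, hij, hne⟩ := hx
  wlog h : i < j generalizing i j
  · exact this j i hij.symm (Ne.symm hne) (lt_of_le_of_ne (not_lt.1 h) (Ne.symm hne))
  refine Finset.prod_eq_zero (Finset.mem_univ j) (Finset.prod_eq_zero (Finset.mem_Iio.2 h) ?_)
  rw [hij, cmpSign_self]

theorem leviCivita_perm (σ : Equiv.Perm (Fin 7)) : leviCivita σ = (Equiv.Perm.sign σ : ℤ) := by
  rw [Equiv.Perm.sign_eq_prod_prod_Iio, Units.coe_prod]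
  refine Finset.prod_congr rfl fun j _ => ?_
  rw [Units.coe_prod]
  refine Finset.prod_congr rfl fun i hi => ?_
  have hne : (σ i).val ≠ (σ j).val := fun h =>
    (Finset.mem_Iio.1 hi).ne (σ.injective (Fin.ext h))
  rcases lt_or_gt_of_ne hne with h | h
  · rw [cmpSign_of_lt h, if_pos (Fin.lt_def.2 h)]
    rfl
  · rw [cmpSign_of_gt h, if_neg (show ¬ σ i < σ j from not_lt.2 (Fin.le_def.2 h.le))]
    rfl

/-- Non-injective maps contribute zero. Summing over all maps lets the sum split into one
independent sum per index, as in `phiCubeContraction`. -/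
theorem sum_perm_eq_sum_leviCivita (g : (Fin 7 → Fin 7) → ℤ) :
    ∑ σ : Equiv.Perm (Fin 7), (Equiv.Perm.sign σ : ℤ) * g σ = ∑ x, leviCivita x * g x := by
  symm
  refine (Finset.sum_of_injOn (fun σ : Equiv.Perm (Fin 7) => (σ : Fin 7 → Fin 7))
    (fun σ _ τ _ h => DFunLike.coe_injective h) (by simp) ?_ ?_).symm
  · intro x _ hx
    rw [leviCivita_eq_zero, zero_mul]
    intro hinj
    exact hx ⟨Equiv.ofBijective x (Finite.injective_iff_bijective.1 hinj), by simp, rfl⟩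
  · intro σ _
    rw [leviCivita_perm]

theorem sum_perm_phiCoeff (i j : Fin 7) :
    ∑ σ : Equiv.Perm (Fin 7), (Equiv.Perm.sign σ : ℤ) *
      (phiCoeff i (σ 0) (σ 1) * phiCoeff j (σ 2) (σ 3) * phiCoeff (σ 4) (σ 5) (σ 6))
      = if i = j then 144 else 0 := by
  rw [← phiCubeContraction_eq, sum_perm_eq_sum_leviCivita (fun x =>
    phiCoeff i (x 0) (x 1) * phiCoeff j (x 2) (x 3) * phiCoeff (x 4) (x 5) (x 6))]
  simp only [phiCubeContraction, lazyMul_eq, sumSeven_eq, Finset.mul_sum]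
  -- Peels off the seven values of `x` in order, matching the nested sums over `a, …, g`.
  iterate 7 rw [Fintype.sum_fin_succ_arrow]; refine Finset.sum_congr rfl fun _ _ => ?_
  rw [Fintype.sum_unique]
  have key : ∀ x : Fin 7 → Fin 7, leviCivita x =
      ∏ j, ∏ i, if i < j then cmpSign (x i) (x j) else 1 := by
    intro x
    refine Finset.prod_congr rfl fun j _ => ?_
    rw [← Finset.prod_filter]
    congr 1
    ext; simp
  rw [key]
  simp [Fin.prod_univ_succ]
  ring

/-- `phiCoeff` as a signed sum of Kronecker determinants. -/
theorem phiCoeff_eq : ∀ i j k : Fin 7, phiCoeff i j k =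
    (let D (a b c : Fin 7) : ℤ :=
      let δ (p q : Fin 7) : ℤ := if p = q then 1 else 0
      δ i a * δ j b * δ k c - δ i a * δ j c * δ k b - δ i b * δ j a * δ k c
        + δ i b * δ j c * δ k a + δ i c * δ j a * δ k b - δ i c * δ j b * δ k a
    D 0 1 2 + D 0 3 4 + D 0 5 6 + D 1 3 5 - D 1 4 6 - D 2 3 6 - D 2 4 5) := by
  decide +kernel

theorem phi0_single (i j k : Fin 7) :
    phi0 ![Pi.single i 1, Pi.single j 1, Pi.single k 1] = phiCoeff i j k := by
  rw [phiCoeff_eq]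
  have h (p q : Fin 7) : (Pi.single p 1 : Fin 7 → ℝ) q = if p = q then 1 else 0 := by
    rw [Pi.single_apply]; simp [eq_comm]
  simp only [phi0, dx3, Matrix.det_fin_three, Matrix.of_apply, Matrix.cons_val_zero,
    Matrix.cons_val_one, Matrix.cons_val, h]
  push_cast
  rfl

end Combinatorics

/-! ### Adapted bases are oriented orthonormal for a common inner product and orientation -/

section AdaptedBases

namespace AlternatingMap

variable {V : Type*} [AddCommGroup V] [Module ℝ V] (φ : V [⋀^Fin 3]→ₗ[ℝ] ℝ)

theorem map_three_add_snd (a b b' c : V) : φ ![a, b + b', c] = φ ![a, b, c] + φ ![a, b', c] :=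
  (φ.curryLeft a).map_vecCons_add ![c] b b'

theorem map_three_smul_snd (t : ℝ) (a b c : V) : φ ![a, t • b, c] = t * φ ![a, b, c] :=
  (φ.curryLeft a).map_vecCons_smul ![c] t b

theorem map_three_add_trd (a b c c' : V) : φ ![a, b, c + c'] = φ ![a, b, c] + φ ![a, b, c'] :=
  ((φ.curryLeft a).curryLeft b).map_vecCons_add ![] c c'

theorem map_three_smul_trd (t : ℝ) (a b c : V) : φ ![a, b, t • c] = t * φ ![a, b, c] :=
  ((φ.curryLeft a).curryLeft b).map_vecCons_smul ![] t c

theorem map_three_add_fst (a a' b c : V) : φ ![a + a', b, c] = φ ![a, b, c] + φ ![a', b, c] :=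
  φ.map_vecCons_add ![b, c] a a'

theorem map_three_smul_fst (t : ℝ) (a b c : V) : φ ![t • a, b, c] = t * φ ![a, b, c] :=
  φ.map_vecCons_smul ![b, c] t a

/-- The 7-linear map `(u ⌟ φ) ⊗ (v ⌟ φ) ⊗ φ`. -/
def cube (u v : V) : MultilinearMap ℝ (fun _ : Fin 7 => V) ℝ where
  toFun w := φ ![u, w 0, w 1] * φ ![v, w 2, w 3] * φ ![w 4, w 5, w 6]
  map_update_add' w i x y := by
    have := Subsingleton.elim ‹DecidableEq (Fin 7)› (instDecidableEqFin 7)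
    subst this
    fin_cases i <;>
      simp [map_three_add_snd, map_three_add_fst, map_three_add_trd] <;> ring
  map_update_smul' w i c x := by
    have := Subsingleton.elim ‹DecidableEq (Fin 7)› (instDecidableEqFin 7)
    subst this
    fin_cases i <;>
      simp [map_three_smul_snd, map_three_smul_fst, map_three_smul_trd] <;>
      ring

/-- The 7-form `(u ⌟ φ) ∧ (v ⌟ φ) ∧ φ`, up to a constant factor. -/
noncomputable def cubeForm (u v : V) : V [⋀^Fin 7]→ₗ[ℝ] ℝ :=
  MultilinearMap.alternatization (φ.cube u v)

theorem cubeForm_apply (u v : V) (w : Fin 7 → V) :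
    φ.cubeForm u v w = ∑ σ : Equiv.Perm (Fin 7), ((Equiv.Perm.sign σ : ℤ) : ℝ) *
      (φ ![u, w (σ 0), w (σ 1)] * φ ![v, w (σ 2), w (σ 3)] * φ ![w (σ 4), w (σ 5), w (σ 6)]) := by
  rw [cubeForm, MultilinearMap.alternatization_apply]
  refine Finset.sum_congr rfl fun σ _ => ?_
  rw [Units.smul_def, zsmul_eq_mul]
  rfl

theorem map_three_sum_smul_fst {ι : Type*} (s : Finset ι) (r : ι → ℝ) (e : ι → V) (b c : V) :
    φ ![∑ i ∈ s, r i • e i, b, c] = ∑ i ∈ s, r i * φ ![e i, b, c] := by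
  classical
  induction s using Finset.induction_on with
  | empty => simpa using φ.map_three_smul_fst 0 0 b c
  | insert i s hi ih => rw [Finset.sum_insert hi, Finset.sum_insert hi, map_three_add_fst,
      map_three_smul_fst, ih]

theorem apply_eq_mul_det {ι : Type*} [Fintype ι] [DecidableEq ι] (b : Basis ι ℝ V)
    (f : V [⋀^ι]→ₗ[ℝ] ℝ) (v : ι → V) : f v = f b * b.det v :=
  congrArg (fun f => f v) (f.eq_smul_basis_det b)

theorem basis_det_mul_eq_of_apply_eq {b : Basis (Fin 7) ℝ V} {v : Fin 7 → V}
    (f : V [⋀^Fin 7]→ₗ[ℝ] ℝ) (x y : ℝ) (hb : f b = 144 * x) (hv : f v = 144 * y) :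
    b.det v * x = y := by
  rw [f.apply_eq_mul_det b v, hb, mul_assoc] at hv
  rw [mul_comm, mul_left_cancel₀ (by norm_num) hv]

end AlternatingMap

variable {V : Type*} [AddCommGroup V] [Module ℝ V] [TopologicalSpace V]
  {φ : V [⋀^Fin 3]→L[ℝ] ℝ} {b b' : Basis (Fin 7) ℝ V}

namespace IsAdaptedBasis

theorem apply_basis (hb : IsAdaptedBasis φ b) (i j k : Fin 7) :
    φ ![b i, b j, b k] = phiCoeff i j k := by
  rw [← phi0_single, hb]
  congr 1
  funext r
  fin_cases r <;> simp [Finsupp.single_eq_pi_single]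

/-- This is how `φ` determines its metric: by bilinearity in `u` and `v` the claim reduces to basis
vectors, where it is `sum_perm_phiCoeff`. -/
theorem cubeForm_apply_basis (hb : IsAdaptedBasis φ b) (u v : V) :
    φ.toAlternatingMap.cubeForm u v b
      = 144 * ∑ i, b.repr u i * b.repr v i := by
  have expand (u x y : V) : φ ![u, x, y] = ∑ i, b.repr u i * φ ![b i, x, y] := by
    conv_lhs => rw [← b.sum_repr u]
    exact φ.toAlternatingMap.map_three_sum_smul_fst _ _ _ _ _
  have key (i j : Fin 7) : ∑ σ : Equiv.Perm (Fin 7), ((Equiv.Perm.sign σ : ℤ) : ℝ) *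
      (phiCoeff i (σ 0) (σ 1) * phiCoeff j (σ 2) (σ 3) * phiCoeff (σ 4) (σ 5) (σ 6))
      = if i = j then 144 else 0 := by
    have := congrArg (Int.cast : ℤ → ℝ) (sum_perm_phiCoeff i j)
    push_cast at this
    exact this
  rw [AlternatingMap.cubeForm_apply]
  simp only [ContinuousAlternatingMap.coe_toAlternatingMap]
  calc _ = ∑ i, ∑ j, b.repr u j * b.repr v i * ∑ σ : Equiv.Perm (Fin 7),
        ((Equiv.Perm.sign σ : ℤ) : ℝ) *
        (phiCoeff j (σ 0) (σ 1) * phiCoeff i (σ 2) (σ 3) * phiCoeff (σ 4) (σ 5) (σ 6)) := by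
        simp only [expand u, expand v, hb.apply_basis, Finset.mul_sum, Finset.sum_mul]
        rw [Finset.sum_comm]
        refine Finset.sum_congr rfl fun i _ => ?_
        rw [Finset.sum_comm]
        exact Finset.sum_congr rfl fun j _ => Finset.sum_congr rfl fun σ _ => by ring
    _ = _ := by
        rw [Finset.mul_sum]
        refine Finset.sum_congr rfl fun i _ => ?_
        rw [Finset.sum_eq_single i (fun j _ hj => by rw [key, if_neg hj, mul_zero]) (by simp), key,
          if_pos rfl]
        ring

/-- The top-degree form `cubeForm` at `b' i`, `b' j` takes values on `b` and `b'` that differ by the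
factor `b.det b'`, and both values are known inner products. -/
theorem gram_mul_det (hb : IsAdaptedBasis φ b) (hb' : IsAdaptedBasis φ b') (i j : Fin 7) :
    b.det b' * ∑ k, b.repr (b' i) k * b.repr (b' j) k = if i = j then 1 else 0 := by
  have h : ∑ k, b'.repr (b' i) k * b'.repr (b' j) k = if i = j then (1 : ℝ) else 0 := by
    simp [Finsupp.single_apply]
  rw [← h]
  exact AlternatingMap.basis_det_mul_eq_of_apply_eq _ _ _
    (hb.cubeForm_apply_basis (b' i) (b' j))
    (hb'.cubeForm_apply_basis (b' i) (b' j))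

theorem det_mul_transpose_mul (hb : IsAdaptedBasis φ b) (hb' : IsAdaptedBasis φ b') :
    b.det b' • ((b.toMatrix b').transpose * b.toMatrix b') = 1 := by
  ext i j
  rw [Matrix.smul_apply, Matrix.mul_apply, Matrix.one_apply, ← hb.gram_mul_det hb' i j]
  rfl

theorem det_eq_one (hb : IsAdaptedBasis φ b) (hb' : IsAdaptedBasis φ b') : b.det b' = 1 := by
  have h := congrArg Matrix.det (hb.det_mul_transpose_mul hb')
  rw [Matrix.det_smul, Matrix.det_mul, Matrix.det_transpose, Matrix.det_one, ← Basis.det_apply,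
    Fintype.card_fin] at h
  -- Seven factors come from the scalar in a 7×7 matrix, two from `AᵀA`. The exponent is odd, so the
  -- real root is unique.
  have h9 : (b.det b') ^ 9 = 1 ^ 9 := by rw [one_pow, ← h]; ring
  exact (Odd.strictMono_pow (by decide : Odd 9)).injective h9

theorem toMatrix_mul_transpose (hb : IsAdaptedBasis φ b) (hb' : IsAdaptedBasis φ b') :
    b.toMatrix b' * (b.toMatrix b').transpose = 1 := by
  have h := hb.det_mul_transpose_mul hb'
  rw [hb.det_eq_one hb', one_smul] at h
  exact mul_eq_one_comm.1 h

end IsAdaptedBasis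

end AdaptedBases

/-! ### Invariance and naturality of the Hodge star -/

section HodgeStar

theorem MultilinearMap.map_basis_eq_sum {V W ι κ : Type*} [AddCommGroup V] [Module ℝ V]
    [AddCommGroup W] [Module ℝ W] [Fintype ι] [Fintype κ] [DecidableEq κ]
    (b : Basis ι ℝ V) (F : MultilinearMap ℝ (fun _ : κ => V) W) (v : κ → V) :
    F v = ∑ c : κ → ι, (∏ a, b.repr (v a) (c a)) • F fun a => b (c a) := by
  conv_lhs => enter [2, a]; rw [← b.sum_repr (v a)]
  rw [F.map_sum]
  exact Finset.sum_congr rfl fun c _ => F.map_smul_univ _ _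

/-- Contraction over an orthonormal basis does not depend on the basis: after expanding `b'` in `b`,
the sums over `b'` of products of coordinates collapse to Kronecker deltas. -/
theorem MultilinearMap.sum_smul_basis_eq {V W ι κ : Type*} [AddCommGroup V] [Module ℝ V]
    [AddCommGroup W] [Module ℝ W] [Fintype ι] [DecidableEq ι] [Fintype κ] [DecidableEq κ]
    {b b' : Basis ι ℝ V} (h : b.toMatrix b' * (b.toMatrix b').transpose = 1)
    (F : MultilinearMap ℝ (fun _ : κ => V) ℝ) (G : MultilinearMap ℝ (fun _ : κ => V) W) :
    ∑ i : κ → ι, F (fun a => b' (i a)) • G (fun a => b' (i a))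
      = ∑ i : κ → ι, F (fun a => b (i a)) • G (fun a => b (i a)) := by
  have hM (c d : ι) : ∑ i, b.repr (b' i) c * b.repr (b' i) d = if c = d then 1 else 0 := by
    have := congrFun (congrFun h c) d
    rwa [Matrix.mul_apply, Matrix.one_apply] at this
  calc _ = ∑ i : κ → ι, ∑ c : κ → ι, ∑ d : κ → ι,
        (∏ a, b.repr (b' (i a)) (c a) * b.repr (b' (i a)) (d a)) •
          (F (fun a => b (c a)) • G fun a => b (d a)) := by
        refine Finset.sum_congr rfl fun i _ => ?_
        rw [F.map_basis_eq_sum b, G.map_basis_eq_sum b, Finset.sum_smul]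
        refine Finset.sum_congr rfl fun c _ => ?_
        rw [Finset.smul_sum]
        refine Finset.sum_congr rfl fun d _ => ?_
        rw [Finset.prod_mul_distrib, smul_smul, smul_smul, smul_eq_mul]
        congr 1
        ring
    _ = ∑ c : κ → ι, ∑ d : κ → ι,
        (∏ a, ∑ i, b.repr (b' i) (c a) * b.repr (b' i) (d a)) •
          (F (fun a => b (c a)) • G fun a => b (d a)) := by
        rw [Finset.sum_comm]
        refine Finset.sum_congr rfl fun c _ => ?_
        rw [Finset.sum_comm]
        refine Finset.sum_congr rfl fun d _ => ?_
        rw [← Finset.sum_smul, Fintype.prod_sum]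
    _ = _ := by
        refine Finset.sum_congr rfl fun c _ => ?_
        rw [Finset.sum_eq_single c]
        · simp [hM]
        · intro d _ hd
          obtain ⟨a, ha⟩ := Function.ne_iff.1 hd.symm
          rw [Finset.prod_eq_zero (Finset.mem_univ a) (by rw [hM, if_neg ha]), zero_smul]
        · simp

variable {V : Type*} [AddCommGroup V] [Module ℝ V] [TopologicalSpace V]
  [IsTopologicalAddGroup V] [ContinuousSMul ℝ V] [T2Space V]

theorem hodgeStarOfBasis_apply {n k l : ℕ} (b : Basis (Fin n) ℝ V) (h : k + l = n)
    (α : V [⋀^Fin k]→L[ℝ] ℝ) (v : Fin l → V) :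
    hodgeStarOfBasis b h α v = ((k.factorial : ℝ)⁻¹) *
      ∑ i : Fin k → Fin n, α (fun a => b (i a)) *
        b.det (Fin.append (fun a => b (i a)) v ∘ Fin.cast h.symm) := by
  rw [hodgeStarOfBasis, ContinuousAlternatingMap.smul_apply, ContinuousAlternatingMap.sum_apply]
  rfl

theorem hodgeStarOfBasis_zero {n k l : ℕ} (b : Basis (Fin n) ℝ V) (h : k + l = n) :
    hodgeStarOfBasis b h (0 : V [⋀^Fin k]→L[ℝ] ℝ) = 0 := by
  simp [hodgeStarOfBasis]

theorem hodgeStarOfBasis_congr {n k l : ℕ} {b b' : Basis (Fin n) ℝ V} (hdet : b.det b' = 1)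
    (hM : b.toMatrix b' * (b.toMatrix b').transpose = 1) (h : k + l = n)
    (α : V [⋀^Fin k]→L[ℝ] ℝ) : hodgeStarOfBasis b h α = hodgeStarOfBasis b' h α := by
  ext v
  subst h
  have hd : b.det = b'.det := by
    rw [AlternatingMap.eq_smul_basis_det b' b.det, hdet, one_smul]
  rw [hodgeStarOfBasis_apply, hodgeStarOfBasis_apply, ← hd]
  congr 1
  -- Currying the volume form after `k` slots exhibits the star as a contraction of `α` with a
  -- multilinear map in those slots.
  let G := (b.det.toMultilinearMap.domDomCongr finSumFinEquiv.symm).currySum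
  have hG (w : Fin k → V) : b.det (Fin.append w v ∘ Fin.cast rfl) = G w v := by
    simp only [G, MultilinearMap.currySum_apply, MultilinearMap.domDomCongr_apply]
    refine congrArg b.det (funext fun a => ?_)
    refine Fin.addCases (fun c => ?_) (fun c => ?_) a <;> simp
  have := congrArg (fun f => f v) (MultilinearMap.sum_smul_basis_eq hM α.toMultilinearMap G)
  simp only [sum_apply, smul_apply, smul_eq_mul] at this
  simp only [hG]
  exact this.symm

/-- Replaces the basis picked by choice with any adapted one, in particular with a smooth frame. -/
theorem IsAdaptedBasis.g2Star_eq {φ : V [⋀^Fin 3]→L[ℝ] ℝ} {b : Basis (Fin 7) ℝ V}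
    (hb : IsAdaptedBasis φ b) {k l : ℕ} (h : k + l = 7) (α : V [⋀^Fin k]→L[ℝ] ℝ) :
    g2Star φ h α = hodgeStarOfBasis b h α := by
  have hex : ∃ b : Basis (Fin 7) ℝ V, IsAdaptedBasis φ b := ⟨b, hb⟩
  rw [g2Star, dif_pos hex]
  exact hodgeStarOfBasis_congr (hex.choose_spec.det_eq_one hb)
    (hex.choose_spec.toMatrix_mul_transpose hb) h α

theorem g2Star_zero (φ : V [⋀^Fin 3]→L[ℝ] ℝ) {k l : ℕ} (h : k + l = 7) :
    g2Star φ h (0 : V [⋀^Fin k]→L[ℝ] ℝ) = 0 := by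
  unfold g2Star
  split_ifs
  · exact hodgeStarOfBasis_zero _ h
  · rfl

/-- Pulled back along `A`, the volume form of `b` is a multiple of `e.det`, and evaluating on `w`
shows that the factor is `(e.det w)⁻¹`. With `e` fixed, this is the formula from which smoothness of
the star is read off. -/
theorem hodgeStarOfBasis_apply_comp {E : Type*} [AddCommGroup E] [Module ℝ E] {n k l : ℕ}
    {b : Basis (Fin n) ℝ V} (h : k + l = n) (α : V [⋀^Fin k]→L[ℝ] ℝ) (e : Basis (Fin n) ℝ E)
    (A : E →ₗ[ℝ] V) {w : Fin n → E} (hw : ∀ i, A (w i) = b i) (v : Fin l → E) :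
    e.det w ≠ 0 ∧ hodgeStarOfBasis b h α (A ∘ v) = ((k.factorial : ℝ)⁻¹) *
      ∑ i : Fin k → Fin n, α (fun a => A (w (i a))) *
        ((e.det w)⁻¹ * e.det (Fin.append (fun a => w (i a)) v ∘ Fin.cast h.symm)) := by
  have hA (u : Fin n → E) : b.det (A ∘ u) = b.det (A ∘ e) * e.det u :=
    (b.det.compLinearMap A).apply_eq_mul_det e u
  have h1 : b.det (A ∘ e) * e.det w = 1 := by
    rw [← hA, show A ∘ w = b from funext hw, b.det_self]
  have h0 : e.det w ≠ 0 := right_ne_zero_of_mul_eq_one h1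
  refine ⟨h0, ?_⟩
  rw [hodgeStarOfBasis_apply]
  congr 1
  refine Finset.sum_congr rfl fun i _ => ?_
  simp only [hw]
  rw [← eq_inv_of_mul_eq_one_left h1, ← hA]
  congr 2
  subst h
  funext a
  refine Fin.addCases (fun c => ?_) (fun c => ?_) a <;> simp [hw]

end HodgeStar

/-! ### Injectivity of the wedge product with `φ` on 1-forms -/

section WedgeInjective

variable {V : Type*} [AddCommGroup V] [Module ℝ V] [TopologicalSpace V]

/-- The terms of `φ₀` are the lines of a Fano plane. Take a line `jkl` missing `i`, ordered to have
sign `+`: two of its points already determine it, so no term contains `i` and two of them.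
Evaluating `α ∧ φ` on these four basis vectors then leaves only `α (b i)`. -/
theorem exists_phiCoeff_isolated : ∀ i : Fin 7, ∃ j k l : Fin 7, phiCoeff j k l = 1 ∧
    phiCoeff i k l = 0 ∧ phiCoeff i j l = 0 ∧ phiCoeff i j k = 0 := by
  decide +kernel

/-- `α ∧ φ = 0` only if `α = 0`, for a 1-form `α` and a 3-form `φ` with an adapted basis. -/
theorem IsAdaptedBasis.eq_zero_of_wedge_eq_zero {φ : V [⋀^Fin 3]→L[ℝ] ℝ} {b : Basis (Fin 7) ℝ V}
    (hb : IsAdaptedBasis φ b) {α : V →ₗ[ℝ] ℝ}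
    (h : ∀ v : Fin 4 → V, ∑ i, (-1) ^ i.val * (α (v i) * φ (i.removeNth v)) = 0) : α = 0 := by
  refine b.ext fun i => ?_
  obtain ⟨j, k, l, h1, h2, h3, h4⟩ := exists_phiCoeff_isolated i
  have hv := h ![b i, b j, b k, b l]
  have e0 : (0 : Fin 4).removeNth ![b i, b j, b k, b l] = ![b j, b k, b l] := by
    funext r; fin_cases r <;> rfl
  have e1 : (1 : Fin 4).removeNth ![b i, b j, b k, b l] = ![b i, b k, b l] := by
    funext r; fin_cases r <;> rfl
  have e2 : (2 : Fin 4).removeNth ![b i, b j, b k, b l] = ![b i, b j, b l] := by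
    funext r; fin_cases r <;> rfl
  have e3 : (3 : Fin 4).removeNth ![b i, b j, b k, b l] = ![b i, b j, b k] := by
    funext r; fin_cases r <;> rfl
  rw [Fin.sum_univ_four, e0, e1, e2, e3, hb.apply_basis, hb.apply_basis, hb.apply_basis,
    hb.apply_basis, h1, h2, h3, h4] at hv
  simpa using hv

end WedgeInjective

/-! ### Smoothness of form-valued maps -/

section SmoothForms

open scoped Topology

variable {E : Type*} [NormedAddCommGroup E] [NormedSpace ℝ E]

theorem contDiffAt_continuousAlternatingMap_iff {G : Type*} [NormedAddCommGroup G]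
    [NormedSpace ℝ G] {ι : Type*} [Fintype ι] (e : Basis ι ℝ E) {k : ℕ} {n : WithTop ℕ∞}
    {f : G → E [⋀^Fin k]→L[ℝ] ℝ} {y : G} :
    ContDiffAt ℝ n f y ↔ ∀ v : Fin k → E, ContDiffAt ℝ n (fun z => f z v) y := by
  constructor
  · intro hf v
    exact (ContinuousAlternatingMap.apply ℝ E ℝ v).contDiff.contDiffAt.comp y hf
  · intro hf
    let L : (E [⋀^Fin k]→L[ℝ] ℝ) →ₗ[ℝ] ((Fin k → ι) → ℝ) :=
      { toFun := fun α c => α fun a => e (c a)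
        map_add' := fun _ _ => rfl
        map_smul' := fun _ _ => rfl }
    have hL : Function.Injective L := by
      intro α β h
      apply ContinuousAlternatingMap.toAlternatingMap_injective
      exact Basis.ext_alternating e fun c _ => congrFun h c
    -- `R` is defined on a finite-dimensional space, hence continuous, and recovers `f` from its
    -- components.
    obtain ⟨R, hR⟩ := L.exists_leftInverse_of_injective (LinearMap.ker_eq_bot.2 hL)
    have h1 : f = fun z => LinearMap.toContinuousLinearMap R (L (f z)) :=
      funext fun z => (LinearMap.congr_fun hR (f z)).symm
    rw [h1]
    exact (LinearMap.toContinuousLinearMap R).contDiff.contDiffAt.comp y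
      (contDiffAt_pi.2 fun c => hf _)

theorem ContDiffAt.continuousAlternatingMap_apply_of_basis {G : Type*} [NormedAddCommGroup G]
    [NormedSpace ℝ G] [FiniteDimensional ℝ E] {ι : Type*} [Fintype ι] (e : Basis ι ℝ E) {k : ℕ}
    {n : WithTop ℕ∞} {f : G → E [⋀^Fin k]→L[ℝ] ℝ} {v : G → Fin k → E} {y : G}
    (hf : ContDiffAt ℝ n f y) (hv : ∀ a, ContDiffAt ℝ n (fun z => v z a) y) :
    ContDiffAt ℝ n (fun z => f z (v z)) y := by
  have h1 (z : G) : f z (v z) =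
      ∑ c : Fin k → ι, (∏ a, e.repr (v z a) (c a)) * f z fun a => e (c a) :=
    (f z).toMultilinearMap.map_basis_eq_sum e (v z)
  simp only [h1]
  refine ContDiffAt.sum fun c _ => ContDiffAt.mul (contDiffAt_prod fun a _ => ?_)
    ((contDiffAt_continuousAlternatingMap_iff e).1 hf _)
  exact (LinearMap.toContinuousLinearMap (e.coord (c a))).contDiff.contDiffAt.comp y (hv a)

theorem ContDiffAt.basis_det {G : Type*} [NormedAddCommGroup G]
    [NormedSpace ℝ G] [FiniteDimensional ℝ E] {m : ℕ} (e : Basis (Fin m) ℝ E)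
    {n : WithTop ℕ∞} {v : G → Fin m → E} {y : G}
    (hv : ∀ a, ContDiffAt ℝ n (fun z => v z a) y) :
    ContDiffAt ℝ n (fun z => e.det (v z)) y := by
  have h1 (z : G) : e.det (v z) =
      ∑ c : Fin m → Fin m, (∏ a, e.repr (v z a) (c a)) * e.det fun a => e (c a) :=
    e.det.toMultilinearMap.map_basis_eq_sum e (v z)
  simp only [h1]
  refine ContDiffAt.sum fun c _ => ContDiffAt.mul (contDiffAt_prod fun a _ => ?_) contDiffAt_const
  exact (LinearMap.toContinuousLinearMap (e.coord (c a))).contDiff.contDiffAt.comp y (hv a)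

theorem ContDiffAt.extDeriv {k : ℕ} {η : E → E [⋀^Fin k]→L[ℝ] ℝ} {y : E}
    (hη : ContDiffAt ℝ ∞ η y) : ContDiffAt ℝ ∞ (_root_.extDeriv η) y := by
  have h : ContDiffAt ℝ ∞ (fderiv ℝ η) y := hη.fderiv_right le_rfl
  let D : (E →L[ℝ] E [⋀^Fin k]→L[ℝ] ℝ) →L[ℝ] E [⋀^Fin (k + 1)]→L[ℝ] ℝ :=
    ContinuousAlternatingMap.alternatizeUncurryFinCLM ℝ E ℝ
  exact D.contDiff.contDiffAt.comp y h

end SmoothForms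

/-! ### Forms in charts -/

section Charts

open scoped Topology

local notation "E₇" => EuclideanSpace ℝ (Fin 7)

variable {M : Type*} [TopologicalSpace M] [ChartedSpace E₇ M]

/-- The derivative of the chart at `x₀`. -/
noncomputable def chartDeriv (x₀ p : M) : E₇ →L[ℝ] E₇ := mfderiv (𝓡 7) (𝓡 7) (extChartAt (𝓡 7) x₀) p

/-- The derivative of the inverse of the chart at `x₀`. -/
noncomputable def chartSymmDeriv (x₀ : M) (y : E₇) : E₇ →L[ℝ] E₇ :=
  mfderiv (𝓡 7) (𝓡 7) (extChartAt (𝓡 7) x₀).symm y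

section

variable [IsManifold (𝓡 7) ∞ M]

theorem chartSymmDeriv_comp_chartDeriv {x₀ p : M} {y : E₇} (hy : y ∈ (extChartAt (𝓡 7) x₀).target)
    (hp : (extChartAt (𝓡 7) x₀).symm y = p) :
    (chartSymmDeriv x₀ y).comp (chartDeriv x₀ p) = ContinuousLinearMap.id ℝ E₇ := by
  subst hp
  have := mfderivWithin_extChartAt_symm_comp_mfderiv_extChartAt (I := 𝓡 7) hy
  rw [ModelWithCorners.range_eq_univ, mfderivWithin_univ] at this
  exact this

theorem chartDeriv_self (x : M) : chartDeriv x x = ContinuousLinearMap.id ℝ E₇ :=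
  mfderiv_extChartAt_self

theorem chartSymmDeriv_self (x : M) :
    chartSymmDeriv x (extChartAt (𝓡 7) x x) = ContinuousLinearMap.id ℝ E₇ := by
  have := mfderivWithin_range_extChartAt_symm (I := 𝓡 7) (x := x)
  rw [ModelWithCorners.range_eq_univ, mfderivWithin_univ] at this
  exact this

theorem contMDiffAt_extChartAt_symm {x₀ : M} {y : E₇} (hy : y ∈ (extChartAt (𝓡 7) x₀).target) :
    ContMDiffAt (𝓡 7) (𝓡 7) ∞ (extChartAt (𝓡 7) x₀).symm y :=
  (contMDiffOn_extChartAt_symm x₀).contMDiffAt ((isOpen_extChartAt_target x₀).mem_nhds hy)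

theorem contDiffAt_transition {x₀ x₁ : M} {y : E₇} (hy : y ∈ (extChartAt (𝓡 7) x₀).target)
    (hp : (extChartAt (𝓡 7) x₀).symm y ∈ (extChartAt (𝓡 7) x₁).source) :
    ContDiffAt ℝ ∞ (extChartAt (𝓡 7) x₁ ∘ (extChartAt (𝓡 7) x₀).symm) y := by
  rw [← contMDiffAt_iff_contDiffAt]
  rw [extChartAt_source] at hp
  exact (contMDiffAt_extChartAt' hp).comp y (contMDiffAt_extChartAt_symm hy)

theorem fderiv_transition {x₀ x₁ : M} {y : E₇} (hy : y ∈ (extChartAt (𝓡 7) x₀).target)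
    (hp : (extChartAt (𝓡 7) x₀).symm y ∈ (extChartAt (𝓡 7) x₁).source) :
    fderiv ℝ (extChartAt (𝓡 7) x₁ ∘ (extChartAt (𝓡 7) x₀).symm) y =
      (chartDeriv x₁ ((extChartAt (𝓡 7) x₀).symm y)).comp (chartSymmDeriv x₀ y) := by
  rw [extChartAt_source] at hp
  rw [← mfderiv_eq_fderiv]
  exact mfderiv_comp y (mdifferentiableAt_extChartAt hp)
    ((contMDiffAt_extChartAt_symm hy).mdifferentiableAt (by simp))

end

namespace DiffForm

theorem inChart_apply {k : ℕ} (η : DiffForm M k) {x₀ p : M} {y : E₇}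
    (hp : (extChartAt (𝓡 7) x₀).symm y = p) (v : Fin k → E₇) :
    η.inChart x₀ y v = η p (fun a => chartSymmDeriv x₀ y (v a)) := by
  subst hp; rfl

theorem extD_apply {k : ℕ} (η : DiffForm M k) (p : M) (v : Fin (k + 1) → TangentSpace (𝓡 7) p) :
    η.extD p v = extDeriv (η.inChart p) (extChartAt (𝓡 7) p p) (fun a => chartDeriv p p (v a)) :=
  rfl

theorem extD_zero {k : ℕ} : (0 : DiffForm M k).extD = 0 := by
  funext p
  have h0 : (0 : DiffForm M k).inChart p = 0 := by
    funext y; ext v; rfl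
  have h1 : extDeriv (0 : E₇ → E₇ [⋀^Fin k]→L[ℝ] ℝ) (extChartAt (𝓡 7) p p) = 0 := by
    rw [extDeriv, fderiv_zero]
    exact map_zero (ContinuousAlternatingMap.alternatizeUncurryFinCLM ℝ E₇ ℝ)
  ext v
  rw [extD_apply, h0, h1]
  rfl

theorem IsSmooth.contDiffAt {k : ℕ} {η : DiffForm M k} (hη : η.IsSmooth) {x₀ : M} {y : E₇}
    (hy : y ∈ (extChartAt (𝓡 7) x₀).target) : ContDiffAt ℝ ∞ (η.inChart x₀) y :=
  (hη x₀).contDiffAt ((isOpen_extChartAt_target x₀).mem_nhds hy)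

theorem IsSmooth.const_smul {k : ℕ} {η : DiffForm M k} (hη : η.IsSmooth) (c : ℝ) :
    (c • η).IsSmooth := by
  intro x₀
  have : (c • η).inChart x₀ = fun y => c • η.inChart x₀ y := by
    funext y; ext v; rfl
  rw [this]
  exact ContDiffOn.const_smul c (hη x₀)

variable [IsManifold (𝓡 7) ∞ M]

/-- The derivative of the chart at `x₁` cancels against that of its inverse, leaving the pullback
under the transition map. -/
theorem inChart_transition {k : ℕ} (η : DiffForm M k) {x₀ x₁ : M} {y : E₇}
    (hy : y ∈ (extChartAt (𝓡 7) x₀).target)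
    (hp : (extChartAt (𝓡 7) x₀).symm y ∈ (extChartAt (𝓡 7) x₁).source) :
    η.inChart x₀ y =
      (η.inChart x₁ ((extChartAt (𝓡 7) x₁ ∘ (extChartAt (𝓡 7) x₀).symm) y)).compContinuousLinearMap
        (fderiv ℝ (extChartAt (𝓡 7) x₁ ∘ (extChartAt (𝓡 7) x₀).symm) y) := by
  have hs : (extChartAt (𝓡 7) x₁).symm ((extChartAt (𝓡 7) x₁ ∘ (extChartAt (𝓡 7) x₀).symm) y) =
      (extChartAt (𝓡 7) x₀).symm y := (extChartAt (𝓡 7) x₁).left_inv hp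
  ext v
  rw [ContinuousAlternatingMap.compContinuousLinearMap_apply, inChart_apply η hs,
    inChart_apply η rfl, fderiv_transition hy hp]
  refine congrArg _ (funext fun a => ?_)
  exact (DFunLike.congr_fun
    (chartSymmDeriv_comp_chartDeriv ((extChartAt (𝓡 7) x₁).map_source hp) hs)
    (chartSymmDeriv x₀ y (v a))).symm

/-- The exterior derivative of forms can be computed in any chart. -/
theorem IsSmooth.inChart_extD {k : ℕ} {η : DiffForm M k} (hη : η.IsSmooth) {x₀ : M} {y : E₇}
    (hy : y ∈ (extChartAt (𝓡 7) x₀).target) :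
    η.extD.inChart x₀ y = extDeriv (η.inChart x₀) y := by
  set p := (extChartAt (𝓡 7) x₀).symm y with hp
  set g : E₇ → E₇ := extChartAt (𝓡 7) p ∘ (extChartAt (𝓡 7) x₀).symm with hg
  have hps : p ∈ (extChartAt (𝓡 7) p).source := mem_extChartAt_source p
  have hev : η.inChart x₀ =ᶠ[𝓝 y]
      fun z => (η.inChart p (g z)).compContinuousLinearMap (fderiv ℝ g z) := by
    have hcont : ContinuousAt (extChartAt (𝓡 7) x₀).symm y := continuousAt_extChartAt_symm'' hy
    filter_upwards [(isOpen_extChartAt_target x₀).mem_nhds hy,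
      hcont.preimage_mem_nhds ((isOpen_extChartAt_source p).mem_nhds hps)] with z hz hz'
    exact inChart_transition η hz hz'
  -- `extD` at `p` uses the chart at `p`, which need not be the one at `x₀`; naturality of
  -- `extDeriv` under the transition map `g` reconciles them.
  rw [hev.extDeriv_eq, extDeriv_pullback (r := ∞)
    (show DifferentiableAt ℝ (η.inChart p) (g y) from
      (hη.contDiffAt ((extChartAt (𝓡 7) p).map_source hps)).differentiableAt (by simp))
    (show ContDiffAt ℝ ∞ g y from contDiffAt_transition hy hps) (by simp [minSmoothness_of_isRCLikeNormedField]; norm_cast),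
    hg, fderiv_transition hy hps]
  ext v
  exact (inChart_apply _ hp.symm v).trans (extD_apply η p _)

theorem IsSmooth.extD {k : ℕ} {η : DiffForm M k} (hη : η.IsSmooth) : η.extD.IsSmooth := by
  intro x₀ y hy
  refine ContDiffAt.contDiffWithinAt ((hη.contDiffAt hy).extDeriv.congr_of_eventuallyEq ?_)
  filter_upwards [(isOpen_extChartAt_target x₀).mem_nhds hy] with z hz
  exact hη.inChart_extD hz

theorem IsSmooth.extD_extD {k : ℕ} {η : DiffForm M k} (hη : η.IsSmooth) : η.extD.extD = 0 := by
  funext p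
  ext v
  have hp := mem_extChartAt_target (I := 𝓡 7) p
  -- A whole neighbourhood is needed, since the outer derivative sees `η.extD` near `p` and not only
  -- at `p`.
  have hev : η.extD.inChart p =ᶠ[𝓝 (extChartAt (𝓡 7) p p)] extDeriv (η.inChart p) := by
    filter_upwards [(isOpen_extChartAt_target p).mem_nhds hp] with z hz
    exact hη.inChart_extD hz
  rw [extD_apply, hev.extDeriv_eq, extDeriv_extDeriv_apply (hη.contDiffAt hp)
    (by simp [minSmoothness_of_isRCLikeNormedField]; norm_cast)]
  rfl

end DiffForm

end Charts

/-! ### Forms on a manifold with a `G₂`-structure -/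

section G2Structures

open scoped Topology

local notation "E₇" => EuclideanSpace ℝ (Fin 7)

variable {M : Type*} [TopologicalSpace M] [ChartedSpace E₇ M]

theorem DiffForm.star_zero (φ : DiffForm M 3) {k l : ℕ} (h : k + l = 7) :
    DiffForm.star φ h (0 : DiffForm M k) = 0 :=
  funext fun _ => g2Star_zero _ h

theorem DiffForm.codiff_zero (φ : DiffForm M 3) {k l : ℕ} (h : (k + 1) + l = 7) :
    DiffForm.codiff φ h (0 : DiffForm M (k + 1)) = 0 := by
  rw [DiffForm.codiff, DiffForm.star_zero, DiffForm.extD_zero, DiffForm.star_zero, smul_zero]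

variable [IsManifold (𝓡 7) ∞ M]

/-- The trivialization of the tangent bundle at `x₀` acts on fibres as the derivative of the chart
at `x₀`, so the expression is the fibre coordinate of a smooth section. -/
theorem contDiffAt_chartDeriv_section {X : (p : M) → TangentSpace (𝓡 7) p} {x₀ : M} {y : E₇}
    (hy : y ∈ (extChartAt (𝓡 7) x₀).target)
    (hX : ContMDiffAt (𝓡 7) ((𝓡 7).prod 𝓘(ℝ, E₇)) ∞
      (fun p => (⟨p, X p⟩ : TangentBundle (𝓡 7) M)) ((extChartAt (𝓡 7) x₀).symm y)) :
    ContDiffAt ℝ ∞ (fun z => chartDeriv x₀ ((extChartAt (𝓡 7) x₀).symm z)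
      (X ((extChartAt (𝓡 7) x₀).symm z))) y := by
  have hs : (extChartAt (𝓡 7) x₀).symm y ∈ (chartAt E₇ x₀).source := by
    rw [← extChartAt_source (𝓡 7)]; exact (extChartAt (𝓡 7) x₀).map_target hy
  have h1 := (((trivializationAt E₇ (TangentSpace (𝓡 7)) x₀).contMDiffAt_iff
    (IB := 𝓡 7) (n := ∞) (f := fun p => (⟨p, X p⟩ : TangentBundle (𝓡 7) M)) (by
      rw [Bundle.Trivialization.mem_source]; exact hs)).1 hX).2
  rw [← contMDiffAt_iff_contDiffAt]
  refine (h1.comp y (contMDiffAt_extChartAt_symm hy)).congr_of_eventuallyEq ?_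
  filter_upwards [(isOpen_extChartAt_target x₀).mem_nhds hy] with z hz
  have hs : (extChartAt (𝓡 7) x₀).symm z ∈ (chartAt E₇ x₀).source := by
    rw [← extChartAt_source (𝓡 7)]; exact (extChartAt (𝓡 7) x₀).map_target hz
  have h2 := TangentBundle.continuousLinearMapAt_trivializationAt (I := 𝓡 7) hs
  have h3 := DFunLike.congr_fun h2 (X ((extChartAt (𝓡 7) x₀).symm z))
  refine h3.symm.trans ?_
  exact congrFun (Bundle.Trivialization.coe_linearMapAt_of_mem _ hs) _

/-- In a chart, with a smooth adapted frame written as `w`, the components of the star are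
polynomial in those of `α` and `w`, divided by the nonvanishing `c.det (w z)`. -/
theorem DiffForm.IsSmooth.star {φ : DiffForm M 3} (hφ : IsG2Structure φ) {k l : ℕ} (h : k + l = 7)
    {α : DiffForm M k} (hα : α.IsSmooth) : (DiffForm.star φ h α).IsSmooth := by
  intro x₀ y hy
  refine ContDiffAt.contDiffWithinAt ?_
  obtain ⟨U, hU, hpU, e, he, hb⟩ := hφ.2 ((extChartAt (𝓡 7) x₀).symm y)
  let c : Basis (Fin 7) ℝ E₇ := (EuclideanSpace.basisFun (Fin 7) ℝ).toBasis
  let w (z : E₇) (i : Fin 7) : E₇ := chartDeriv x₀ ((extChartAt (𝓡 7) x₀).symm z)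
    (e i ((extChartAt (𝓡 7) x₀).symm z))
  have hw (i : Fin 7) : ContDiffAt ℝ ∞ (fun z => w z i) y :=
    contDiffAt_chartDeriv_section hy (he.contMDiffAt hU hpU i)
  have key (z : E₇) (hz : z ∈ (extChartAt (𝓡 7) x₀).target)
      (hzU : (extChartAt (𝓡 7) x₀).symm z ∈ U) (v : Fin l → E₇) :
      c.det (w z) ≠ 0 ∧ (DiffForm.star φ h α).inChart x₀ z v = ((k.factorial : ℝ)⁻¹) *
      ∑ i : Fin k → Fin 7, α.inChart x₀ z (fun a => w z (i a)) *
        ((c.det (w z))⁻¹ * c.det (Fin.append (fun a => w z (i a)) v ∘ Fin.cast h.symm)) := by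
    have hAw (i : Fin 7) : chartSymmDeriv x₀ z (w z i) = he.toBasisAt hzU i := by
      rw [he.toBasisAt_coe]
      exact DFunLike.congr_fun (chartSymmDeriv_comp_chartDeriv hz rfl) _
    have h1 := hodgeStarOfBasis_apply_comp (b := he.toBasisAt hzU) h
      (α ((extChartAt (𝓡 7) x₀).symm z)) c (chartSymmDeriv x₀ z).toLinearMap hAw v
    refine ⟨h1.1, ?_⟩
    rw [← (hb _ hzU).g2Star_eq] at h1
    exact h1.2
  rw [contDiffAt_continuousAlternatingMap_iff c]
  intro v
  have hev : (fun z => (DiffForm.star φ h α).inChart x₀ z v) =ᶠ[𝓝 y] fun z =>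
      ((k.factorial : ℝ)⁻¹) * ∑ i : Fin k → Fin 7, α.inChart x₀ z (fun a => w z (i a)) *
        ((c.det (w z))⁻¹ * c.det (Fin.append (fun a => w z (i a)) v ∘ Fin.cast h.symm)) := by
    filter_upwards [(isOpen_extChartAt_target x₀).mem_nhds hy,
      (continuousAt_extChartAt_symm'' hy).preimage_mem_nhds (hU.mem_nhds hpU)] with z hz hz'
    exact (key z hz hz' v).2
  refine ContDiffAt.congr_of_eventuallyEq ?_ hev
  refine contDiffAt_const.mul (ContDiffAt.sum fun i _ => ContDiffAt.mul ?_ (ContDiffAt.mul ?_ ?_))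
  · exact (hα.contDiffAt hy).continuousAlternatingMap_apply_of_basis c fun a => hw (i a)
  · exact (ContDiffAt.basis_det c hw).inv (key y hy hpU v).1
  · refine ContDiffAt.basis_det c fun a => ?_
    simp only [Function.comp_apply]
    refine Fin.addCases (fun a => ?_) (fun a => ?_) (Fin.cast h.symm a)
    · simpa using hw (i a)
    · simpa using contDiffAt_const

theorem DiffForm.IsSmooth.codiff {φ : DiffForm M 3} (hφ : IsG2Structure φ) {k l : ℕ}
    (h : (k + 1) + l = 7) {α : DiffForm M (k + 1)} (hα : α.IsSmooth) :
    (DiffForm.codiff φ h α).IsSmooth :=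
  ((hα.star hφ h).extD.star hφ _).const_smul _


theorem DiffForm.extDeriv_inChart_self_eq_zero {k : ℕ} {η : DiffForm M k} (h : η.extD = 0)
    (x : M) : extDeriv (η.inChart x) (extChartAt (𝓡 7) x x) = 0 := by
  ext v
  have h1 : extDeriv (η.inChart x) (extChartAt (𝓡 7) x x) (fun a => chartDeriv x x (v a)) = 0 :=
    (η.extD_apply x v).symm.trans (by rw [h]; rfl)
  rwa [chartDeriv_self] at h1

/-- Leibniz rule `d(Fη) = F dη + dF ∧ η`; the sum is `dF ∧ η` evaluated on `v`. -/
theorem sum_fderiv_mul_eq_zero_of_extDeriv_smul {E : Type*} [NormedAddCommGroup E]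
    [NormedSpace ℝ E] {k : ℕ} {F : E → ℝ} {η : E → E [⋀^Fin k]→L[ℝ] ℝ} {y : E}
    (hF : DifferentiableAt ℝ F y) (hη : DifferentiableAt ℝ η y) (h0 : extDeriv η y = 0)
    (h : extDeriv (fun z => F z • η z) y = 0) (v : Fin (k + 1) → E) :
    ∑ i, (-1) ^ i.val * (fderiv ℝ F y (v i) * η y (i.removeNth v)) = 0 := by
  have h1 := extDeriv_apply (hF.fun_smul hη) v
  have h2 := extDeriv_apply hη v
  have hsplit (i : Fin (k + 1)) : fderiv ℝ (fun z => (F z • η z) (i.removeNth v)) y (v i) =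
      F y * fderiv ℝ (fun z => η z (i.removeNth v)) y (v i)
        + fderiv ℝ F y (v i) * η y (i.removeNth v) := by
    have h3 := (hF.hasFDerivAt.mul
      (hη.continuousAlternatingMap_apply_const (i.removeNth v)).hasFDerivAt).fderiv
    refine (DFunLike.congr_fun h3 (v i)).trans ?_
    simp only [add_apply, smul_apply, smul_eq_mul]
    ring
  rw [h, ContinuousAlternatingMap.coe_zero, Pi.zero_apply] at h1
  rw [h0, ContinuousAlternatingMap.coe_zero, Pi.zero_apply] at h2
  have h4 : F y * ∑ i : Fin (k + 1),
      (-1) ^ i.val • fderiv ℝ (fun z => η z (i.removeNth v)) y (v i) = 0 := by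
    rw [← h2, mul_zero]
  simp only [hsplit, smul_add, Finset.sum_add_distrib] at h1
  simp only [Finset.mul_sum] at h4
  simp only [zsmul_eq_mul, mul_left_comm (F y)] at h1 h4
  rw [h4, zero_add] at h1
  push_cast at h1
  exact h1.symm

/-- For a closed form `φ` with adapted bases, `d(fφ) = df ∧ φ` vanishes only if `df` does. -/
theorem fderiv_eq_zero_of_extD_smul_eq_zero {φ : DiffForm M 3} (hφ : IsG2Structure φ)
    (hclosed : φ.extD = 0) {f : M → ℝ} (hf : ContMDiff (𝓡 7) 𝓘(ℝ, ℝ) ∞ f)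
    (h : DiffForm.extD (fun x => f x • φ x) = 0) (x : M) :
    fderiv ℝ (f ∘ (extChartAt (𝓡 7) x).symm) (extChartAt (𝓡 7) x x) = 0 := by
  have hx := mem_extChartAt_target (I := 𝓡 7) x
  have hF : DifferentiableAt ℝ (f ∘ (extChartAt (𝓡 7) x).symm) (extChartAt (𝓡 7) x x) :=
    (contMDiffAt_iff_contDiffAt.1
      (hf.contMDiffAt.comp _ (contMDiffAt_extChartAt_symm hx))).differentiableAt (by simp)
  have hsum := sum_fderiv_mul_eq_zero_of_extDeriv_smul hF
    ((hφ.1.contDiffAt hx).differentiableAt (by simp))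
    (DiffForm.extDeriv_inChart_self_eq_zero hclosed x)
    (DiffForm.extDeriv_inChart_self_eq_zero h x)
  have hφx (u : Fin 3 → E₇) : φ.inChart x (extChartAt (𝓡 7) x x) u = φ x u := by
    rw [DiffForm.inChart_apply _ (extChartAt_to_inv x), chartSymmDeriv_self]
    rfl
  simp only [hφx] at hsum
  obtain ⟨U, -, hxU, e, he, hb⟩ := hφ.2 x
  have h0 := (hb x hxU).eq_zero_of_wedge_eq_zero
    (α := (fderiv ℝ (f ∘ (extChartAt (𝓡 7) x).symm) (extChartAt (𝓡 7) x x)).toLinearMap) hsum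
  exact ContinuousLinearMap.ext fun v => LinearMap.congr_fun h0 v

theorem isLocallyConstant_of_fderiv_inChart_eq_zero {f : M → ℝ} (hf : ContMDiff (𝓡 7) 𝓘(ℝ, ℝ) ∞ f)
    (h : ∀ x, fderiv ℝ (f ∘ (extChartAt (𝓡 7) x).symm) (extChartAt (𝓡 7) x x) = 0) :
    IsLocallyConstant f := by
  -- The hypothesis only concerns the centre of each chart. As a statement about `mfderiv` it holds
  -- independently of charts, and the chain rule carries it to a whole ball in one fixed chart.
  have hm (x : M) : mfderiv (𝓡 7) 𝓘(ℝ, ℝ) f x = 0 := by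
    have h1 : fderivWithin ℝ (f ∘ (extChartAt (𝓡 7) x).symm) (Set.range (𝓡 7))
        (extChartAt (𝓡 7) x x) = 0 := by
      rw [ModelWithCorners.range_eq_univ, fderivWithin_univ, h x]
    exact (hf.mdifferentiableAt (by simp)).mfderiv.trans h1
  rw [IsLocallyConstant.iff_eventually_eq]
  intro x
  obtain ⟨r, hr, hball⟩ := Metric.isOpen_iff.1 (isOpen_extChartAt_target (I := 𝓡 7) x) _
    (mem_extChartAt_target x)
  have hF (y : E₇) (hy : y ∈ Metric.ball (extChartAt (𝓡 7) x x) r) :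
      ContDiffAt ℝ ∞ (f ∘ (extChartAt (𝓡 7) x).symm) y :=
    contMDiffAt_iff_contDiffAt.1
      (hf.contMDiffAt.comp _ (contMDiffAt_extChartAt_symm (hball hy)))
  have hconst (p : E₇) (hp : p ∈ Metric.ball (extChartAt (𝓡 7) x x) r) :
      (f ∘ (extChartAt (𝓡 7) x).symm) p
        = (f ∘ (extChartAt (𝓡 7) x).symm) (extChartAt (𝓡 7) x x) :=
    Metric.isOpen_ball.is_const_of_fderiv_eq_zero
    (f := f ∘ (extChartAt (𝓡 7) x).symm) (convex_ball _ r).isPreconnected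
    (fun y hy => ((hF y hy).differentiableAt (by simp)).differentiableWithinAt)
    (fun y hy => by
      rw [← mfderiv_eq_fderiv]
      have h1 := mfderiv_comp y (hf.mdifferentiableAt (by simp))
        ((contMDiffAt_extChartAt_symm (hball hy)).mdifferentiableAt (by simp))
      rw [hm] at h1
      exact h1.trans (ContinuousLinearMap.zero_comp _))
    hp (Metric.mem_ball_self hr)
  have hnear : ∀ᶠ p in 𝓝 x, extChartAt (𝓡 7) x p ∈ Metric.ball (extChartAt (𝓡 7) x x) r :=
    (continuousAt_extChartAt x).preimage_mem_nhds (Metric.ball_mem_nhds _ hr)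
  filter_upwards [hnear, extChartAt_source_mem_nhds (I := 𝓡 7) x] with p hp hps
  have := hconst _ hp
  rwa [Function.comp_apply, Function.comp_apply, (extChartAt (𝓡 7) x).left_inv hps,
    extChartAt_to_inv] at this

end G2Structures

/-! ### The characterisation of closed eigenforms -/

theorem proposition2 {M : Type*} [TopologicalSpace M]
    [ChartedSpace (EuclideanSpace ℝ (Fin 7)) M] [IsManifold (𝓡 7) ∞ M] [ConnectedSpace M]
    (φ : DiffForm M 3) (hφ : IsG2Structure φ) (hclosed : φ.IsClosedForm) :
    IsEigenform φ ↔ DiffForm.hodgeLaplacian φ φ ∈ Omega31 φ := by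
  constructor
  · rintro ⟨c, hc⟩
    exact ⟨fun _ => c, contMDiff_const, hc⟩
  · rintro ⟨f, hf, hfφ⟩
    have hlap : DiffForm.hodgeLaplacian φ φ
        = (DiffForm.codiff φ (k := 2) (l := 4) rfl φ).extD := by
      rw [DiffForm.hodgeLaplacian, show φ.extD = 0 from hclosed, DiffForm.codiff_zero, add_zero]
    have hd : DiffForm.extD (fun x => f x • φ x) = 0 := by
      rw [← hfφ, hlap]
      exact (DiffForm.IsSmooth.codiff hφ rfl hφ.1).extD_extD
    -- Connectedness of `M` enters here, through `exists_eq_const`.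
    obtain ⟨c, rfl⟩ := (isLocallyConstant_of_fderiv_inChart_eq_zero hf
      (fderiv_eq_zero_of_extD_smul_eq_zero hφ hclosed hf hd)).exists_eq_const
    exact ⟨c, hfφ⟩
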